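/- Let $r\ge 0$ and $p\ge 1$ be integers, and let $f\in D^{r,1}([0,1]) = C^r([0,1])\cap C^{r+2}_{pw}([0,1])$; that is, $f$ is real valued and $C^r$ on $[0,1]$, and there are $0=t_0<\dots<t_N=1$ such that $f$ is $C^{r+2}$ on each $(t_j,t_{j+1})$ and $f^{(r+2)}|_{(t_j,t_{j+1})}$ extends continuously to $[t_j,t_{j+1}]$. For $1\le m\le r$ let $a^m_0,\dots,a^m_{m+p-1}$ be real coefficients, independent of $n$, such that the one-sided difference operators $$\mathcal D^{m,\pm}_{n,p}(g)(x) = (\pm n)^m\sum_{k=0}^{m+p-1} a^m_k\, g\!\left(x\pm \tfrac kn\right)$$ approximate the $m$-th derivative with order of accuracy $p$: for every $g\in C^\infty(\mathbb R)$ and $x\in\mathbb R$, $\mathcal D^{m,\pm}_{n,p}(g)(x)-g^{(m)}(x)=\mathcal O(n^{-p})$ as $n\to\infty$. For $n\ge \max\{1,r+p-1\}$ let $F_{n,p}=(f_{i,m})_{i\in\{0,1\},\,0\le m\le r}$ be given by $f_{0,0}=f(0)$, $f_{1,0}=f(1)$, and $f_{0,m}=\mathcal D^{m,+}_{n,p}(f)(0)$,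 $f_{1,m}=\mathcal D^{m,-}_{n,p}(f)(1)$ for $1\le m\le r$. Let $$\mathcal P_r(F)(x)=(1+x)^{r+1}\sum_{m=0}^r\frac{f_{0,m}}{m!}\sum_{i=0}^{r-m}(-1)^i\binom{r+i}{i}x^{m+i}+(-x)^{r+1}\sum_{m=0}^r\frac{f_{1,m}}{m!}\sum_{i=0}^{r-m}\binom{r+i}{i}(1+x)^{m+i}$$ be the two-point Hermite interpolation polynomial at $0$ and $-1$, where $F=(f_{i,m})$. Define the continued grid data by $(\hat f^d_c)_j=f(j/n)$ for $0\le j\le n$ and $(\hat f^d_c)_j=\mathcal P_r(F_{n,p})(j/n)$ for $-n\le j\le -1$. Put $$c^d_k(\hat f^d_c)=\frac1{2n}\sum_{j=-n}^{n-1}(\hat f^d_c)_j\,e^{-\pi i jk/n},\qquad \mathcal T^d_{n,2}(\hat f^d_c)(x)=\sum_{k=-n}^{n-1}c^d_k(\hat f^d_c)\,e^{\pi i kx}.$$ Then there is a constant $C>0$, independent of $n$, such that for all $n\ge \max\{1,r+p-1\}$ $$\bigl\|\mathcal T^d_{n,2}(\hat f^d_c)-f\bigr\|_{\infty,[0,1]}\le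 \frac{C}{n^{\min\{p,r\}+1}}.$$ -/

import Mathlib

namespace FourierContinuation

/-- `f` is piecewise `C^ℓ` on `[a,b]`: there are finitely many break points
`a = t 0 < t 1 < ⋯ < t N = b` such that on every open piece `f` has `ℓ` continuous derivatives and
the restriction of `f^(ℓ)` to the open piece extends continuously to the closed piece. -/
def PiecewiseCk (ℓ : ℕ) (f : ℝ → ℝ) (a b : ℝ) : Prop :=
  ∃ (N : ℕ) (t : Fin (N + 1) → ℝ), StrictMono t ∧ t 0 = a ∧ t (Fin.last N) = b ∧
    ∀ j : Fin N,
      ContDiffOn ℝ ℓ f (Set.Ioo (t j.castSucc) (t j.succ)) ∧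
      ∃ h : ℝ → ℝ, ContinuousOn h (Set.Icc (t j.castSucc) (t j.succ)) ∧
        Set.EqOn (iteratedDeriv ℓ f) h (Set.Ioo (t j.castSucc) (t j.succ))

/-- The space `D^{r,1}([a,b])` of functions that are `C^r` on `[a,b]` and piecewise `C^{r+2}`. -/
def MemD (r : ℕ) (f : ℝ → ℝ) (a b : ℝ) : Prop :=
  ContDiffOn ℝ r f (Set.Icc a b) ∧ PiecewiseCk (r + 2) f a b

/-- The one-sided finite difference operator of the `m`-th derivative with `m + p` nodes,
step `1 / n` and coefficients `c 0, …, c (m + p - 1)`; forward for `σ = 1`, backward for `σ = -1`: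
`(σ n)^m ∑_{k=0}^{m+p-1} c_k g(x + σ k / n)`. -/
noncomputable def finiteDiff (σ : ℝ) (m p : ℕ) (c : ℕ → ℝ) (n : ℕ) (g : ℝ → ℝ) (x : ℝ) : ℝ :=
  (σ * n) ^ m * ∑ k ∈ Finset.range (m + p), c k * g (x + σ * (k / n))

/-- The forward and the backward difference operators with coefficients `c` approximate the `m`-th
derivative with order of accuracy `p`: for smooth functions the error is `O(n^{-p})`. -/
def HasAccuracy (m p : ℕ) (c : ℕ → ℝ) : Prop :=
  ∀ σ : ℝ, σ = 1 ∨ σ = -1 → ∀ g : ℝ → ℝ, ContDiff ℝ ((⊤ : ℕ∞) : WithTop ℕ∞) g → ∀ x : ℝ,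
    (fun n : ℕ => finiteDiff σ m p c n g x - iteratedDeriv m g x)
      =O[Filter.atTop] (fun n : ℕ => 1 / (n : ℝ) ^ p)

/-- The two-point Hermite interpolation polynomial `P_r(F)` of degree at most `2 r + 1`, whose
derivatives up to order `r` at `0` and at `-1` are the rows `F 0` and `F 1`. -/
noncomputable def hermite (r : ℕ) (F : Matrix (Fin 2) (Fin (r + 1)) ℝ) (x : ℝ) : ℝ :=
  (1 + x) ^ (r + 1) * ∑ m : Fin (r + 1), F 0 m / (m : ℕ).factorial *
      ∑ i ∈ Finset.range (r - m + 1), (-1) ^ i * ((r + i).choose i : ℝ) * x ^ ((m : ℕ) + i)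
  + (-x) ^ (r + 1) * ∑ m : Fin (r + 1), F 1 m / (m : ℕ).factorial *
      ∑ i ∈ Finset.range (r - m + 1), ((r + i).choose i : ℝ) * (1 + x) ^ ((m : ℕ) + i)

/-- The approximate boundary data matrix `F_{n,p}`: the column `0` holds the exact values `f 0`,
`f 1`; the column `m ≥ 1` holds the forward difference at `0` and the backward difference at `1`
with coefficients `a m`. -/
noncomputable def boundaryData (r p : ℕ) (a : ℕ → ℕ → ℝ) (n : ℕ) (f : ℝ → ℝ) :
    Matrix (Fin 2) (Fin (r + 1)) ℝ :=
  ![fun m => if (m : ℕ) = 0 then f 0 else finiteDiff 1 m p (a m) n f 0,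
    fun m => if (m : ℕ) = 0 then f 1 else finiteDiff (-1) m p (a m) n f 1]

/-- The continued grid data on the points `j / n`, `-n ≤ j ≤ n`. -/
noncomputable def continuedData (r p : ℕ) (a : ℕ → ℕ → ℝ) (n : ℕ) (f : ℝ → ℝ) (j : ℤ) : ℝ :=
  if 0 ≤ j then f (j / n) else hermite r (boundaryData r p a n f) (j / n)

/-- The discrete Fourier coefficient
`c^d_k(u) = (1 / 2n) ∑_{j=-n}^{n-1} u_j e^{-π i j k / n}`. -/
noncomputable def discreteCoeff (n : ℕ) (u : ℤ → ℝ) (k : ℤ) : ℂ :=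
  1 / (2 * n) * ∑ j ∈ Finset.Ico (-(n : ℤ)) n,
    (u j : ℂ) * Complex.exp (-(Real.pi * Complex.I * j * k / n))

/-- The interpolating trigonometric polynomial
`T^d_{n,2}(u)(x) = ∑_{k=-n}^{n-1} c^d_k(u) e^{π i k x}`. -/
noncomputable def trigInterp (n : ℕ) (u : ℤ → ℝ) (x : ℝ) : ℂ :=
  ∑ k ∈ Finset.Ico (-(n : ℤ)) n,
    discreteCoeff n u k * Complex.exp (Real.pi * Complex.I * k * x)

end FourierContinuation

/-!
The interpolation operator reproduces the waves of frequency `-n ≤ k < n` and aliases all others to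
them, so its error is at most twice the sum of the Fourier coefficients of frequency `|k| ≥ n`.
Integrating by parts on each smooth piece, a function whose one-sided derivatives of order less than
`s` match at every breakpoint and at the ends `±1` has coefficients `O(|k| ^ (-s - 1))`, and hence
interpolation error `O(n ^ (-s))`.

With exact boundary derivatives the Hermite continuation of `f` satisfies this for `s = r + 1`. The
operator and the continuation are linear in the boundary data, so it remains to bound the response
to a perturbation of the data. The `m`-th finite difference is off by
`O(n ^ m * n ^ (-(min p r + 1)))`. Conversely, the Hermite basis polynomial carrying the `m`-th
derivative has vanishing derivatives of order less than `m` at both nodes, so its continuation by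
zero is interpolated with error `O(n ^ (-m))`: the growth and the decay in `m` cancel.
-/

namespace FourierContinuation

open Finset Filter Topology
open scoped Polynomial

section TrigonometricInterpolation

/-- The `2`-periodic exponential `x ↦ e^{π i k x}`, as a function of a real variable. -/
noncomputable def wave (k : ℤ) (x : ℝ) : ℂ := fourier k (x : AddCircle (2 : ℝ))

lemma wave_eq_exp (k : ℤ) (x : ℝ) : wave k x = Complex.exp (Real.pi * Complex.I * k * x) := by
  rw [wave, fourier_coe_apply]
  congr 1
  push_cast
  ring

lemma norm_wave (k : ℤ) (x : ℝ) : ‖wave k x‖ = 1 := Circle.norm_coe _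

lemma wave_add (k l : ℤ) (x : ℝ) : wave (k + l) x = wave k x * wave l x := fourier_add

lemma wave_sub_right (k : ℤ) (x y : ℝ) : wave k (x - y) = wave k x * wave (-k) y := by
  simp only [wave_eq_exp, ← Complex.exp_add]
  congr 1
  push_cast
  ring

lemma continuous_wave (k : ℤ) : Continuous (wave k) :=
  (fourier k).continuous.comp (AddCircle.continuous_mk' 2)

lemma hasDerivAt_wave (k : ℤ) (x : ℝ) :
    HasDerivAt (wave k) (Real.pi * Complex.I * k * wave k x) x := by
  refine (hasDerivAt_fourier 2 k x).congr_deriv ?_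
  rw [wave]
  push_cast
  ring

lemma wave_neg_one (k : ℤ) : wave k (-1) = wave k 1 := by
  have hperiod := AddCircle.coe_add_period (2 : ℝ) (-1)
  rw [show (-1 : ℝ) + 2 = 1 by norm_num] at hperiod
  rw [wave, ← hperiod, ← wave]

lemma sum_zpow_Ico_eq_zero {K : Type*} [Field K] {z : K} {N : ℕ} (hz : z ≠ 1) (hN : z ^ N = 1)
    (a : ℤ) : ∑ j ∈ Ico a (a + N), z ^ j = 0 := by
  rcases eq_or_ne N 0 with rfl | hN0
  · simp
  have hz0 : z ≠ 0 := by
    rintro rfl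
    simp [hN0] at hN
  have hshift (i : ℕ) : z ^ (a + i : ℤ) = z ^ a * z ^ i := by rw [zpow_add₀ hz0, zpow_natCast]
  rw [Int.Ico_eq_finset_map, sum_map]
  simp [hshift, ← mul_sum, geom_sum_eq hz, hN]

lemma wave_grid_eq_zpow (n : ℕ) (d j : ℤ) : wave d (j / n) = wave d (1 / n) ^ j := by
  rw [wave_eq_exp, wave_eq_exp, ← Complex.exp_int_mul]
  congr 1
  push_cast
  ring

lemma wave_one_div_eq_one_iff {n : ℕ} (hn : n ≠ 0) (d : ℤ) :
    wave d (1 / n) = 1 ↔ (2 * n : ℤ) ∣ d := by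
  have hn' : (n : ℂ) ≠ 0 := by exact_mod_cast hn
  rw [wave_eq_exp, Complex.exp_eq_one_iff]
  refine exists_congr fun m => ?_
  have hscale : (Real.pi * Complex.I * d * ((1 / n : ℝ) : ℂ) = m * (2 * Real.pi * Complex.I)) ↔
      (d : ℂ) = 2 * n * m := by
    push_cast
    have := Complex.I_ne_zero
    field_simp
  rw [hscale]
  norm_cast

lemma sum_wave_grid {n : ℕ} (hn : n ≠ 0) (d : ℤ) :
    ∑ j ∈ Ico (-(n : ℤ)) n, wave d (j / n) = if (2 * n : ℤ) ∣ d then (2 * n : ℂ) else 0 := by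
  have hn' : (n : ℂ) ≠ 0 := by exact_mod_cast hn
  simp only [wave_grid_eq_zpow n d]
  split_ifs with hd
  · rw [(wave_one_div_eq_one_iff hn d).2 hd]
    have hcard : ((n : ℤ) + n).toNat = 2 * n := by omega
    simp [hcard]
  · have hroot : wave d (1 / n) ^ (2 * n) = 1 := by
      rw [wave_eq_exp, ← Complex.exp_nat_mul, Complex.exp_eq_one_iff]
      refine ⟨d, ?_⟩
      push_cast
      field_simp
    have hend : (n : ℤ) = -(n : ℤ) + (2 * n : ℕ) := by push_cast; ring
    have hsum := sum_zpow_Ico_eq_zero (mt (wave_one_div_eq_one_iff hn d).1 hd) hroot (-(n : ℤ))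
    rwa [← hend] at hsum

/-- The Dirichlet-type kernel whose translates by the grid points `j / n`, `-n ≤ j < n`, are the
cardinal functions of trigonometric interpolation on that grid. -/
noncomputable def gridKernel (n : ℕ) (x : ℝ) : ℂ := 1 / (2 * n) * ∑ k ∈ Ico (-(n : ℤ)) n, wave k x

/-- The operator mapping a function to the trigonometric polynomial with frequencies
`-n ≤ k < n` that interpolates it at the grid points `j / n`, `-n ≤ j < n`. -/
noncomputable def trigInterpolant (n : ℕ) : (ℝ → ℂ) →ₗ[ℂ] (ℝ → ℂ) :=
  ∑ j ∈ Ico (-(n : ℤ)) n,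
    (LinearMap.proj (j / n : ℝ)).smulRight fun x => gridKernel n (x - j / n)

lemma trigInterpolant_apply (n : ℕ) (G : ℝ → ℂ) (x : ℝ) :
    trigInterpolant n G x = ∑ j ∈ Ico (-(n : ℤ)) n, G (j / n) * gridKernel n (x - j / n) := by
  simp [trigInterpolant]

lemma trigInterpolant_wave {n : ℕ} {k l : ℤ} (hk : k ∈ Ico (-(n : ℤ)) n)
    (hkl : (2 * n : ℤ) ∣ l - k) : trigInterpolant n (wave l) = wave k := by
  have hn : n ≠ 0 := by
    rintro rfl
    simp at hk
  have hn' : (n : ℂ) ≠ 0 := by exact_mod_cast hn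
  have hunique (m : ℤ) (hm : m ∈ Ico (-(n : ℤ)) n) (hne : m ≠ k) : ¬ (2 * n : ℤ) ∣ l - m := by
    rintro hlm
    have hdvd : (2 * n : ℤ) ∣ m - k := by
      simpa only [sub_sub_sub_cancel_left] using dvd_sub hkl hlm
    rw [mem_Ico] at hk hm
    refine hne (sub_eq_zero.1 (Int.eq_zero_of_abs_lt_dvd hdvd ?_))
    rw [abs_lt]
    omega
  ext x
  calc trigInterpolant n (wave l) x
      = ∑ m ∈ Ico (-(n : ℤ)) n, 1 / (2 * n) *
          (∑ j ∈ Ico (-(n : ℤ)) n, wave (l - m) (j / n)) * wave m x := by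
        simp only [trigInterpolant_apply, gridKernel, mul_sum, sum_mul, wave_sub_right]
        rw [sum_comm]
        refine sum_congr rfl fun m _ => sum_congr rfl fun j _ => ?_
        rw [sub_eq_add_neg, wave_add]
        ring
    _ = wave k x := by
        rw [sum_eq_single_of_mem k hk fun m hm hne => by
          rw [sum_wave_grid hn, if_neg (hunique m hm hne), mul_zero, zero_mul]]
        rw [sum_wave_grid hn, if_pos hkl]
        field_simp

lemma norm_trigInterpolant_wave_sub_le {n : ℕ} (hn : n ≠ 0) (l : ℤ) (x : ℝ) :
    ‖trigInterpolant n (wave l) x - wave l x‖ ≤ if l.natAbs < n then 0 else 2 := by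
  split_ifs with hl
  · rw [trigInterpolant_wave (k := l) (mem_Ico.2 (by omega)) (by simp), sub_self, norm_zero]
  · obtain ⟨m, hm, -⟩ := existsUnique_add_zsmul_mem_Ico (show (0 : ℤ) < 2 * n by omega) l (-n)
    have hk : l + m • (2 * n : ℤ) ∈ Ico (-(n : ℤ)) n := by
      rw [mem_Ico]
      exact ⟨hm.1, by linarith [hm.2]⟩
    rw [trigInterpolant_wave hk (by simp)]
    refine (norm_sub_le _ _).trans ?_
    rw [norm_wave, norm_wave]
    norm_num

lemma hasSum_trigInterpolant {n : ℕ} {c : ℤ → ℂ} {G : ℝ → ℂ}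
    (hG : ∀ j ∈ Ico (-(n : ℤ)) n, HasSum (fun l => c l * wave l (j / n)) (G (j / n))) (x : ℝ) :
    HasSum (fun l => c l * trigInterpolant n (wave l) x) (trigInterpolant n G x) := by
  simp only [trigInterpolant_apply, mul_sum, ← mul_assoc]
  exact hasSum_sum fun j hj => (hG j hj).mul_right _

lemma sum_range_inv_sq_tail_le {n : ℕ} (hn : n ≠ 0) (M : ℕ) :
    ∑ k ∈ range M, (if k < n then (0 : ℝ) else 1 / (k : ℝ) ^ 2) ≤ 2 / n := by
  have hsupport : {k ∈ range M | ¬ k < n} = Ioo (n - 1) M := by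
    ext k
    simp only [mem_filter, mem_range, mem_Ioo]
    omega
  have hpred : ((n - 1 : ℕ) : ℝ) + 1 = n := by exact_mod_cast Nat.sub_add_cancel (by omega : 1 ≤ n)
  rw [sum_ite, sum_const_zero, zero_add, hsupport, ← hpred]
  simpa only [one_div] using sum_Ioo_inv_sq_le (α := ℝ) (n - 1) M

lemma exists_hasSum_inv_sq_tail {n : ℕ} (hn : n ≠ 0) :
    ∃ A ≤ 4 / (n : ℝ),
      HasSum (fun l : ℤ => if l.natAbs < n then (0 : ℝ) else 1 / (l : ℝ) ^ 2) A := by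
  set f : ℤ → ℝ := fun l => if l.natAbs < n then 0 else 1 / (l : ℝ) ^ 2 with hf
  have hnonneg (k : ℕ) : (0 : ℝ) ≤ if k < n then (0 : ℝ) else 1 / (k : ℝ) ^ 2 := by positivity
  have hbound := sum_range_inv_sq_tail_le hn
  have hpos : HasSum (fun k : ℕ => f k) (∑' k : ℕ, if k < n then (0 : ℝ) else 1 / (k : ℝ) ^ 2) := by
    simpa [hf] using (summable_of_sum_range_le hnonneg hbound).hasSum
  have hneg : HasSum (fun k : ℕ => f (-k))
      (∑' k : ℕ, if k < n then (0 : ℝ) else 1 / (k : ℝ) ^ 2) := by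
    simpa [hf] using hpos
  refine ⟨_, ?_, hpos.of_nat_of_neg hneg⟩
  have hzero : f 0 = 0 := by simp [hf]
  rw [hzero, sub_zero]
  linarith [Real.tsum_le_of_sum_range_le hnonneg hbound, add_div (2 : ℝ) 2 n,
    (by norm_num : (2 : ℝ) + 2 = 4)]

lemma div_natCast_mem_Icc {n : ℕ} {j : ℤ} (hj : j ∈ Ico (-(n : ℤ)) n) :
    (j / n : ℝ) ∈ Set.Icc (-1 : ℝ) 1 := by
  rw [mem_Ico] at hj
  have hn : (0 : ℝ) < n := by exact_mod_cast (by omega : 0 < n)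
  rw [Set.mem_Icc, le_div_iff₀ hn, div_le_iff₀ hn]
  constructor
  · exact_mod_cast (by omega : -1 * (n : ℤ) ≤ j)
  · exact_mod_cast (by omega : j ≤ 1 * (n : ℤ))

lemma norm_trigInterpolant_sub_le {s : ℕ} (hs : s ≠ 0) {c : ℤ → ℂ} {C : ℝ}
    (hc : ∀ k : ℤ, k ≠ 0 → ‖c k‖ ≤ C / |(k : ℝ)| ^ (s + 1)) {G : ℝ → ℂ}
    (hG : ∀ x ∈ Set.Icc (-1 : ℝ) 1, HasSum (fun l => c l * wave l x) (G x))
    {n : ℕ} (hn : n ≠ 0) {x : ℝ} (hx : x ∈ Set.Icc (-1 : ℝ) 1) :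
    ‖trigInterpolant n G x - G x‖ ≤ 8 * C / (n : ℝ) ^ s := by
  obtain ⟨t, rfl⟩ := Nat.exists_eq_succ_of_ne_zero hs
  have hC : 0 ≤ C := by simpa using (norm_nonneg _).trans (hc 1 one_ne_zero)
  obtain ⟨A, hA, htail⟩ := exists_hasSum_inv_sq_tail hn
  have herror : HasSum (fun l => c l * trigInterpolant n (wave l) x - c l * wave l x)
      (trigInterpolant n G x - G x) :=
    (hasSum_trigInterpolant (fun j hj => hG _ (div_natCast_mem_Icc hj)) x).sub (hG x hx)
  rw [← herror.tsum_eq]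
  refine (tsum_of_norm_bounded (htail.mul_left (2 * C / (n : ℝ) ^ t)) fun l => ?_).trans ?_
  · rw [← mul_sub, norm_mul]
    have haliasing := norm_trigInterpolant_wave_sub_le hn l x
    split_ifs at haliasing ⊢ with hl
    · rw [norm_le_zero_iff.1 haliasing, norm_zero, mul_zero, mul_zero]
    · have hl0 : l ≠ 0 := by
        rintro rfl
        simp only [Int.natAbs_zero] at hl
        omega
      have hnl : (n : ℝ) ≤ |(l : ℝ)| := by
        rw [← Int.cast_abs, Int.abs_eq_natAbs]
        exact_mod_cast not_lt.1 hl
      have : 0 < |(l : ℝ)| := by positivity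
      calc ‖c l‖ * ‖trigInterpolant n (wave l) x - wave l x‖
          ≤ C / |(l : ℝ)| ^ (t + 1 + 1) * 2 := by gcongr; exact hc l hl0
        _ = 2 * C / |(l : ℝ)| ^ t * (1 / (l : ℝ) ^ 2) := by
            rw [← sq_abs (l : ℝ)]
            field_simp
            ring
        _ ≤ 2 * C / (n : ℝ) ^ t * (1 / (l : ℝ) ^ 2) := by gcongr
  · calc 2 * C / (n : ℝ) ^ t * A ≤ 2 * C / (n : ℝ) ^ t * (4 / n) := by gcongr
      _ = 8 * C / (n : ℝ) ^ (t + 1) := by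
        field_simp
        ring

lemma hasSum_fourierCoeff_liftIco {T : ℝ} [Fact (0 < T)] {a : ℝ} {g : ℝ → ℂ}
    (hg : ContinuousOn g (Set.Icc a (a + T))) (hper : g a = g (a + T))
    (hsumm : Summable (fourierCoeff (AddCircle.liftIco T a g)))
    {x : ℝ} (hx : x ∈ Set.Icc a (a + T)) :
    HasSum (fun k => fourierCoeff (AddCircle.liftIco T a g) k * fourier k (x : AddCircle T))
      (g x) := by
  let F : C(AddCircle T, ℂ) := ⟨AddCircle.liftIco T a g, AddCircle.liftIco_continuous hper hg⟩
  have hT : a < a + T := lt_add_of_pos_right a Fact.out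
  have hvalue : F (x : AddCircle T) = g x := by
    rcases hx.2.lt_or_eq with hlt | rfl
    · exact AddCircle.liftIco_coe_apply ⟨hx.1, hlt⟩
    · rw [AddCircle.coe_add_period, ← hper]
      exact AddCircle.liftIco_coe_apply ⟨le_rfl, hT⟩
  rw [← hvalue]
  exact has_pointwise_sum_fourier_series_of_summable (f := F) hsumm x

lemma summable_of_norm_le_div_abs_pow {E : Type*} [NormedAddCommGroup E] [CompleteSpace E]
    {c : ℤ → E} {C : ℝ} {q : ℕ} (hq : 1 < q)
    (hc : ∀ k : ℤ, k ≠ 0 → ‖c k‖ ≤ C / |(k : ℝ)| ^ q) : Summable c := by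
  refine Summable.of_norm_bounded_eventually
    ((Real.summable_one_div_int_pow.2 hq).abs.mul_left C) ?_
  filter_upwards [(Set.finite_singleton (0 : ℤ)).compl_mem_cofinite] with k hk
  refine (hc k hk).trans_eq ?_
  rw [abs_div, abs_pow, abs_one, mul_one_div]

theorem norm_trigInterpolant_sub_le_of_integral_decay {s : ℕ} (hs : s ≠ 0) {G : ℝ → ℂ}
    (hcont : ContinuousOn G (Set.Icc (-1) 1)) (hper : G (-1) = G 1) {C : ℝ}
    (hdecay : ∀ k : ℤ, k ≠ 0 → ‖∫ x in (-1 : ℝ)..1, G x * wave (-k) x‖ ≤ C / |(k : ℝ)| ^ (s + 1))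
    {n : ℕ} (hn : n ≠ 0) {x : ℝ} (hx : x ∈ Set.Icc (-1 : ℝ) 1) :
    ‖trigInterpolant n G x - G x‖ ≤ 4 * C / (n : ℝ) ^ s := by
  have : Fact ((0 : ℝ) < 2) := ⟨two_pos⟩
  have hend : (-1 : ℝ) + 2 = 1 := by norm_num
  set c : ℤ → ℂ := fourierCoeff (AddCircle.liftIco 2 (-1) G) with hc
  have hcoeff (k : ℤ) : c k = 1 / 2 * ∫ x in (-1 : ℝ)..1, G x * wave (-k) x := by
    rw [hc, fourierCoeff_liftIco_eq, fourierCoeffOn_eq_integral, Complex.real_smul]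
    simp only [smul_eq_mul, hend, mul_comm (G _), wave]
    norm_num
  have hbound (k : ℤ) (hk : k ≠ 0) : ‖c k‖ ≤ C / 2 / |(k : ℝ)| ^ (s + 1) := by
    rw [hcoeff, norm_mul]
    calc ‖(1 / 2 : ℂ)‖ * ‖∫ x in (-1 : ℝ)..1, G x * wave (-k) x‖
        ≤ 1 / 2 * (C / |(k : ℝ)| ^ (s + 1)) := by
          norm_num
          exact hdecay k hk
      _ = C / 2 / |(k : ℝ)| ^ (s + 1) := by ring
  have hseries (y : ℝ) (hy : y ∈ Set.Icc (-1 : ℝ) 1) : HasSum (fun k => c k * wave k y) (G y) :=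
    hasSum_fourierCoeff_liftIco (by rwa [hend]) (by rwa [hend])
      (summable_of_norm_le_div_abs_pow (by omega) hbound) (by rwa [hend])
  convert norm_trigInterpolant_sub_le hs hbound hseries hn hx using 2
  ring

end TrigonometricInterpolation

section FourierIntegrals

/-- `G 0` has the successive derivatives `G 1, …, G n` on `(a, b)`, all of them extending
continuously to `[a, b]`. Carrying the derivatives along as a sequence gives their boundary values
a name without any one-sided derivative. -/
structure IsDerivChain {E : Type*} [NormedAddCommGroup E] [NormedSpace ℝ E] (n : ℕ)
    (G : ℕ → ℝ → E) (a b : ℝ) : Prop where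
  continuousOn : ∀ i ≤ n, ContinuousOn (G i) (Set.Icc a b)
  hasDerivAt : ∀ i < n, ∀ x ∈ Set.Ioo a b, HasDerivAt (G i) (G (i + 1) x) x

lemma IsDerivChain.ofReal {n : ℕ} {G : ℕ → ℝ → ℝ} {a b : ℝ} (hG : IsDerivChain n G a b) :
    IsDerivChain n (fun i x => (G i x : ℂ)) a b where
  continuousOn i hi := Complex.continuous_ofReal.comp_continuousOn (hG.continuousOn i hi)
  hasDerivAt i hi x hx := (hG.hasDerivAt i hi x hx).ofReal_comp

variable {a b c : ℝ} {s : ℕ} {G H : ℕ → ℝ → ℂ} {k : ℤ}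

lemma abs_le_norm_pi_mul_I_mul (k : ℤ) : |(k : ℝ)| ≤ ‖(Real.pi * Complex.I * k : ℂ)‖ := by
  rw [norm_mul, norm_mul, Complex.norm_I, Complex.norm_real, Complex.norm_intCast, mul_one,
    Real.norm_eq_abs, abs_of_pos Real.pi_pos]
  exact le_mul_of_one_le_left (abs_nonneg _) (by linarith [Real.pi_gt_three])

lemma norm_div_pi_mul_I_mul_pow_le (hk : k ≠ 0) (s : ℕ) (z : ℂ) :
    ‖z / (Real.pi * Complex.I * k) ^ s‖ ≤ ‖z‖ / |(k : ℝ)| ^ s := by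
  have : 0 < |(k : ℝ)| := by positivity
  rw [norm_div, norm_pow]
  gcongr
  exact abs_le_norm_pi_mul_I_mul k

lemma integral_mul_wave_eq_of_hasDerivAt {g g' : ℝ → ℂ} (hab : a ≤ b)
    (hg : ContinuousOn g (Set.Icc a b)) (hg' : ContinuousOn g' (Set.Icc a b))
    (hderiv : ∀ x ∈ Set.Ioo a b, HasDerivAt g (g' x) x) (hk : k ≠ 0) :
    ∫ x in a..b, g x * wave (-k) x = (g a * wave (-k) a - g b * wave (-k) b +
      ∫ x in a..b, g' x * wave (-k) x) / (Real.pi * Complex.I * k) := by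
  set w : ℂ := Real.pi * Complex.I * k with hw
  have hw0 : w ≠ 0 := by simp [hw, Real.pi_ne_zero, hk]
  have hprimitive (x : ℝ) : HasDerivAt (fun x => -wave (-k) x / w) (wave (-k) x) x := by
    refine ((hasDerivAt_wave (-k) x).neg.div_const w).congr_deriv ?_
    rw [div_eq_iff hw0, hw]
    push_cast
    ring
  rw [← Set.uIcc_of_le hab] at hg hg'
  rw [intervalIntegral.integral_mul_deriv_eq_deriv_mul_of_hasDerivAt hg
    (fun x _ => (hprimitive x).continuousAt.continuousWithinAt)
    (fun x hx => hderiv x (by rwa [min_eq_left hab, max_eq_right hab] at hx))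
    (fun x _ => hprimitive x) hg'.intervalIntegrable
    ((continuous_wave _).intervalIntegrable _ _)]
  have hscale (x : ℝ) : g' x * (-wave (-k) x / w) = -(g' x * wave (-k) x) / w := by ring
  simp_rw [hscale, intervalIntegral.integral_div, intervalIntegral.integral_neg]
  ring

/-- The contribution of the endpoint `x` to the result of `s` integrations by parts in a Fourier
integral of `G 0` with frequency `k`, where `G i` is the `i`-th derivative of `G 0`. -/
noncomputable def boundaryTerms (s : ℕ) (G : ℕ → ℝ → ℂ) (k : ℤ) (x : ℝ) : ℂ :=
  ∑ i ∈ range s, G i x * wave (-k) x / (Real.pi * Complex.I * k) ^ (i + 1)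

lemma boundaryTerms_congr {x y : ℝ} (hwave : wave (-k) x = wave (-k) y)
    (hGH : ∀ i < s, G i x = H i y) : boundaryTerms s G k x = boundaryTerms s H k y :=
  sum_congr rfl fun i hi => by rw [hwave, hGH i (mem_range.1 hi)]

lemma IsDerivChain.integral_mul_wave_eq (hab : a ≤ b) (hG : IsDerivChain s G a b) (hk : k ≠ 0) :
    ∫ x in a..b, G 0 x * wave (-k) x = boundaryTerms s G k a - boundaryTerms s G k b +
      (∫ x in a..b, G s x * wave (-k) x) / (Real.pi * Complex.I * k) ^ s := by
  induction s with
  | zero => simp [boundaryTerms]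
  | succ s ih =>
    rw [ih ⟨fun i hi => hG.continuousOn i (by omega), fun i hi => hG.hasDerivAt i (by omega)⟩,
      integral_mul_wave_eq_of_hasDerivAt hab (hG.continuousOn s (by omega))
        (hG.continuousOn (s + 1) le_rfl) (hG.hasDerivAt s (by omega)) hk]
    simp only [boundaryTerms, sum_range_succ, div_div, ← pow_succ']
    ring

lemma exists_norm_integral_mul_wave_le {g : ℝ → ℂ} (hg : ContinuousOn g (Set.uIcc a b)) :
    ∃ M, ∀ k, ‖∫ x in a..b, g x * wave k x‖ ≤ M := by
  obtain ⟨M, hM⟩ := isCompact_uIcc.exists_bound_of_continuousOn hg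
  refine ⟨M * |b - a|, fun k => intervalIntegral.norm_integral_le_of_norm_le_const fun x hx => ?_⟩
  rw [norm_mul, norm_wave, mul_one]
  exact hM x (Set.uIoc_subset_uIcc hx)

/-- Up to `O(|k| ^ (-(s + 1)))`, the Fourier integrals of `G 0` over `[a, b]` are given by the
boundary terms of order less than `s`. The jet `G` enters only through `G 0` and through its values
at `a` and `b`, so expansions over adjacent intervals can be concatenated. -/
structure HasBoundaryExpansion (s : ℕ) (G : ℕ → ℝ → ℂ) (a b : ℝ) : Prop where
  continuousOn : ContinuousOn (G 0) (Set.uIcc a b)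
  bound : ∃ C, ∀ k : ℤ, k ≠ 0 → ‖(∫ x in a..b, G 0 x * wave (-k) x) -
    (boundaryTerms s G k a - boundaryTerms s G k b)‖ ≤ C / |(k : ℝ)| ^ (s + 1)

lemma IsDerivChain.hasBoundaryExpansion (hab : a ≤ b) (hG : IsDerivChain (s + 1) G a b) :
    HasBoundaryExpansion s G a b := by
  refine ⟨Set.uIcc_of_le hab ▸ hG.continuousOn 0 (by omega), ?_⟩
  obtain ⟨M, hM⟩ := exists_norm_integral_mul_wave_le
    (Set.uIcc_of_le hab ▸ hG.continuousOn (s + 1) le_rfl)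
  refine ⟨‖G s a‖ + ‖G s b‖ + M, fun k hk => ?_⟩
  have hremainder : (∫ x in a..b, G 0 x * wave (-k) x) -
      (boundaryTerms s G k a - boundaryTerms s G k b) =
      (G s a * wave (-k) a - G s b * wave (-k) b + ∫ x in a..b, G (s + 1) x * wave (-k) x) /
        (Real.pi * Complex.I * k) ^ (s + 1) := by
    rw [hG.integral_mul_wave_eq hab hk, boundaryTerms, boundaryTerms, sum_range_succ,
      sum_range_succ, boundaryTerms, boundaryTerms]
    ring
  rw [hremainder]
  refine (norm_div_pi_mul_I_mul_pow_le hk _ _).trans ?_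
  gcongr
  refine (norm_add_le _ _).trans (add_le_add ((norm_sub_le _ _).trans_eq ?_) (hM _))
  simp only [norm_mul, norm_wave, mul_one]

lemma HasBoundaryExpansion.congr (hG : HasBoundaryExpansion s G a b)
    (hGH : Set.EqOn (G 0) (H 0) (Set.uIcc a b)) (ha : ∀ i < s, G i a = H i a)
    (hb : ∀ i < s, G i b = H i b) : HasBoundaryExpansion s H a b := by
  refine ⟨hG.continuousOn.congr hGH.symm, ?_⟩
  obtain ⟨C, hC⟩ := hG.bound
  refine ⟨C, fun k hk => ?_⟩
  have hintegral : ∫ x in a..b, H 0 x * wave (-k) x = ∫ x in a..b, G 0 x * wave (-k) x :=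
    intervalIntegral.integral_congr fun x hx => by simp only [hGH hx]
  rw [hintegral, ← boundaryTerms_congr rfl ha, ← boundaryTerms_congr rfl hb]
  exact hC k hk

lemma HasBoundaryExpansion.intervalIntegrable (hG : HasBoundaryExpansion s G a b) (k : ℤ) :
    IntervalIntegrable (fun x => G 0 x * wave k x) MeasureTheory.volume a b :=
  (hG.continuousOn.mul (continuous_wave k).continuousOn).intervalIntegrable

lemma HasBoundaryExpansion.trans (hab : HasBoundaryExpansion s G a b)
    (hbc : HasBoundaryExpansion s G b c) : HasBoundaryExpansion s G a c := by
  obtain ⟨C₁, hC₁⟩ := hab.bound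
  obtain ⟨C₂, hC₂⟩ := hbc.bound
  refine ⟨(hab.continuousOn.union_of_isClosed hbc.continuousOn isClosed_Icc isClosed_Icc).mono
    Set.uIcc_subset_uIcc_union_uIcc, C₁ + C₂, fun k hk => ?_⟩
  rw [← intervalIntegral.integral_add_adjacent_intervals (hab.intervalIntegrable _)
    (hbc.intervalIntegrable _), add_div]
  refine le_trans (le_of_eq ?_) (norm_add_le_of_le (hC₁ k hk) (hC₂ k hk))
  congr 1
  ring

theorem HasBoundaryExpansion.exists_norm_trigInterpolant_sub_le (hs : s ≠ 0)
    (hG : HasBoundaryExpansion s G (-1) 1) (hper : ∀ i < s, G i (-1) = G i 1) :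
    ∃ C, 0 ≤ C ∧ ∀ n : ℕ, n ≠ 0 → ∀ x ∈ Set.Icc (-1 : ℝ) 1,
      ‖trigInterpolant n (G 0) x - G 0 x‖ ≤ C / (n : ℝ) ^ s := by
  obtain ⟨C, hC⟩ := hG.bound
  have hdecay (k : ℤ) (hk : k ≠ 0) :
      ‖∫ x in (-1 : ℝ)..1, G 0 x * wave (-k) x‖ ≤ C / |(k : ℝ)| ^ (s + 1) := by
    simpa only [boundaryTerms_congr (wave_neg_one (-k)) hper, sub_self, sub_zero] using hC k hk
  have hC0 : 0 ≤ C := by simpa using (norm_nonneg _).trans (hdecay 1 one_ne_zero)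
  have hcont : ContinuousOn (G 0) (Set.Icc (-1) 1) := by
    simpa only [Set.uIcc_of_le (by norm_num : (-1 : ℝ) ≤ 1)] using hG.continuousOn
  exact ⟨4 * C, by positivity, fun n hn x hx =>
    norm_trigInterpolant_sub_le_of_integral_decay hs hcont (hper 0 (by omega)) hdecay hn hx⟩

/-- The function equal to `φ` on the negative and to `ψ` on the nonnegative half-line. -/
noncomputable def glue (φ ψ : ℝ → ℂ) (x : ℝ) : ℂ := if 0 ≤ x then ψ x else φ x

lemma glue_of_nonneg (φ ψ : ℝ → ℂ) {x : ℝ} (hx : 0 ≤ x) : glue φ ψ x = ψ x := if_pos hx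

lemma glue_of_nonpos {φ ψ : ℝ → ℂ} (h : φ 0 = ψ 0) {x : ℝ} (hx : x ≤ 0) : glue φ ψ x = φ x := by
  rcases hx.lt_or_eq with hlt | rfl
  · exact if_neg (not_le.2 hlt)
  · rw [glue_of_nonneg φ ψ le_rfl, h]

theorem exists_norm_trigInterpolant_glue_sub_le (hs : s ≠ 0)
    (hG : HasBoundaryExpansion s G (-1) 0) (hH : HasBoundaryExpansion s H 0 1)
    (h0 : ∀ i < s, G i 0 = H i 0) (h1 : ∀ i < s, G i (-1) = H i 1) :
    ∃ C, 0 ≤ C ∧ ∀ n : ℕ, n ≠ 0 → ∀ x ∈ Set.Icc (0 : ℝ) 1,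
      ‖trigInterpolant n (glue (G 0) (H 0)) x - H 0 x‖ ≤ C / (n : ℝ) ^ s := by
  have hleft (i : ℕ) (hi : i < s) {x : ℝ} (hx : x ≤ 0) : glue (G i) (H i) x = G i x :=
    glue_of_nonpos (h0 i hi) hx
  have hright (i : ℕ) {x : ℝ} (hx : 0 ≤ x) : glue (G i) (H i) x = H i x := glue_of_nonneg _ _ hx
  have hglue : HasBoundaryExpansion s (fun i => glue (G i) (H i)) (-1) 1 := by
    refine (hG.congr (fun x hx => (hleft 0 (by omega) ?_).symm)
      (fun i hi => (hleft i hi (by norm_num)).symm) (fun i hi => (hleft i hi le_rfl).symm)).trans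
      (hH.congr (fun x hx => (hright 0 ?_).symm) (fun i _ => (hright i le_rfl).symm)
        fun i _ => (hright i zero_le_one).symm)
    · rw [Set.uIcc_of_le (by norm_num)] at hx
      exact hx.2
    · rw [Set.uIcc_of_le zero_le_one] at hx
      exact hx.1
  obtain ⟨C, hC0, hC⟩ := hglue.exists_norm_trigInterpolant_sub_le hs fun i hi => by
    rw [hleft i hi (by norm_num), hright i zero_le_one, h1 i hi]
  refine ⟨C, hC0, fun n hn x hx => ?_⟩
  rw [← hright 0 hx.1]
  exact hC n hn x ⟨by linarith [hx.1], hx.2⟩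

end FourierIntegrals

section HermiteInterpolation

open Polynomial

variable {R : Type*} [CommRing R]

/-- The truncation at degree `L` of the power series of `(1 - X) ^ (-(r + 1))`. -/
noncomputable def truncNegBinomial (R : Type*) [CommRing R] (r L : ℕ) : R[X] :=
  ∑ i ∈ range (L + 1), C ((r + i).choose i : R) * X ^ i

lemma one_sub_X_mul_truncNegBinomial (r L : ℕ) :
    (1 - X) * truncNegBinomial R (r + 1) L =
      truncNegBinomial R r L - C ((r + 1 + L).choose L : R) * X ^ (L + 1) := by
  induction L with
  | zero => simp [truncNegBinomial]
  | succ L ih =>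
    have hpascal : ((r + 1 + (L + 1)).choose (L + 1) : R) =
        (r + 1 + L).choose L + (r + (L + 1)).choose (L + 1) := by
      rw [show r + 1 + (L + 1) = r + 1 + L + 1 by ring, Nat.choose_succ_succ,
        show r + (L + 1) = r + 1 + L by ring]
      push_cast
      rfl
    rw [truncNegBinomial, sum_range_succ, mul_add, ← truncNegBinomial, ih,
      truncNegBinomial.eq_1 R r (L + 1), sum_range_succ, ← truncNegBinomial, hpascal]
    simp only [map_add]
    ring

lemma X_pow_dvd_one_sub_X_pow_mul_truncNegBinomial_sub_one (r L : ℕ) :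
    (X : R[X]) ^ (L + 1) ∣ (1 - X) ^ (r + 1) * truncNegBinomial R r L - 1 := by
  induction r with
  | zero =>
    have hgeom : (1 - X) * truncNegBinomial R 0 L = 1 - X ^ (L + 1) := by
      simpa [truncNegBinomial] using mul_neg_geom_sum (X : R[X]) (L + 1)
    rw [zero_add, pow_one, hgeom, sub_sub_cancel_left]
    exact dvd_neg.2 dvd_rfl
  | succ r ih =>
    rw [pow_succ (1 - X : R[X]), mul_assoc, one_sub_X_mul_truncNegBinomial, mul_sub, sub_right_comm]
    exact dvd_sub ih (((dvd_mul_left _ _).mul_left _))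

lemma eval_iterate_derivative_eq_zero_of_X_sub_C_pow_dvd {P : R[X]} {c : R} {N q : ℕ}
    (h : (X - C c) ^ N ∣ P) (hq : q < N) : (derivative^[q] P).eval c = 0 := by
  obtain ⟨W, hW⟩ := pow_sub_dvd_iterate_derivative_of_pow_dvd q h
  simp [hW, Nat.sub_ne_zero_of_lt hq]

variable {K : Type*} [Field K]

lemma eval_iterate_derivative_inv_factorial_mul_X_sub_C_pow [CharZero K] (c : K) (m q : ℕ) :
    (derivative^[q] (C (1 / (m.factorial : K)) * (X - C c) ^ m)).eval c =
      if q = m then 1 else 0 := by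
  rw [iterate_derivative_C_mul, iterate_derivative_X_sub_pow]
  simp only [eval_mul, eval_C, eval_smul, eval_pow, eval_sub, eval_X, sub_self]
  have hm : (m.factorial : K) ≠ 0 := by exact_mod_cast m.factorial_ne_zero
  rcases lt_trichotomy q m with hlt | rfl | hgt
  · simp [hlt.ne, Nat.sub_ne_zero_of_lt hlt]
  · simp [Nat.descFactorial_self, hm]
  · simp [hgt.ne', Nat.descFactorial_of_lt hgt]

/-- The polynomial of degree at most `2 r + 1` whose derivatives of order at most `r` all vanish at
the nodes `c` and `d`, except for the `m`-th derivative at `c`, which is `1`. With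
`u = (x - c) / (d - c)` it is `(x - c) ^ m / m!` times `(1 - u) ^ (r + 1)`, which is flat at `d`,
times a Taylor polynomial of `(1 - u) ^ (-(r + 1))`, which undoes that factor near `c`. -/
noncomputable def hermiteBasis (r m : ℕ) (c d : K) : K[X] :=
  C (1 / (m.factorial : K)) * (X - C c) ^ m *
    ((1 - C (d - c)⁻¹ * (X - C c)) ^ (r + 1) *
      (truncNegBinomial K r (r - m)).comp (C (d - c)⁻¹ * (X - C c)))

lemma X_sub_C_pow_dvd_hermiteBasis_sub {r m : ℕ} (hm : m ≤ r) (c d : K) :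
    (X - C c) ^ (r + 1) ∣ hermiteBasis r m c d - C (1 / (m.factorial : K)) * (X - C c) ^ m := by
  obtain ⟨W, hW⟩ := X_pow_dvd_one_sub_X_pow_mul_truncNegBinomial_sub_one (R := K) r (r - m)
  have hcomp := congrArg (fun P => P.comp (C (d - c)⁻¹ * (X - C c))) hW
  simp only [sub_comp, mul_comp, pow_comp, one_comp, X_comp] at hcomp
  rw [hermiteBasis, ← mul_sub_one, hcomp, mul_pow, show r + 1 = m + (r - m + 1) by omega,
    pow_add (X - C c)]
  exact mul_dvd_mul (dvd_mul_left _ _) ((dvd_mul_left _ _).mul_right _)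

lemma X_sub_C_pow_dvd_hermiteBasis {c d : K} (hcd : c ≠ d) (r m : ℕ) :
    (X - C d) ^ (r + 1) ∣ hermiteBasis r m c d := by
  have hfactor : 1 - C (d - c)⁻¹ * (X - C c) = -C (d - c)⁻¹ * (X - C d) := by
    have hunit : C (d - c)⁻¹ * (C d - C c) = (1 : K[X]) := by
      rw [← C_sub, ← C_mul, inv_mul_cancel₀ (sub_ne_zero.2 hcd.symm), C_1]
    linear_combination -hunit
  rw [hermiteBasis, hfactor, mul_pow]
  exact ((dvd_mul_left _ _).mul_right _).mul_left _

lemma eval_iterate_derivative_hermiteBasis_left [CharZero K] {r m q : ℕ} (hm : m ≤ r) (hq : q ≤ r)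
    (c d : K) : (derivative^[q] (hermiteBasis r m c d)).eval c = if q = m then 1 else 0 := by
  have hflat := eval_iterate_derivative_eq_zero_of_X_sub_C_pow_dvd
    (X_sub_C_pow_dvd_hermiteBasis_sub hm c d) (Nat.lt_succ_of_le hq)
  rwa [iterate_derivative_sub, eval_sub, eval_iterate_derivative_inv_factorial_mul_X_sub_C_pow,
    sub_eq_zero] at hflat

lemma eval_iterate_derivative_hermiteBasis_right {c d : K} (hcd : c ≠ d) {r q : ℕ} (hq : q ≤ r)
    (m : ℕ) : (derivative^[q] (hermiteBasis r m c d)).eval d = 0 :=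
  eval_iterate_derivative_eq_zero_of_X_sub_C_pow_dvd (X_sub_C_pow_dvd_hermiteBasis hcd r m)
    (Nat.lt_succ_of_le hq)

/-- The two-point Hermite interpolation polynomial whose derivatives of order at most `r` are `A` at
the node `c` and `B` at the node `d`. -/
noncomputable def twoPointHermite (r : ℕ) (c d : K) (A B : Fin (r + 1) → K) : K[X] :=
  ∑ m : Fin (r + 1), (C (A m) * hermiteBasis r m c d + C (B m) * hermiteBasis r m d c)

lemma twoPointHermite_swap (r : ℕ) (c d : K) (A B : Fin (r + 1) → K) :
    twoPointHermite r c d A B = twoPointHermite r d c B A :=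
  sum_congr rfl fun _ _ => add_comm _ _

lemma twoPointHermite_sub (r : ℕ) (c d : K) (A B A' B' : Fin (r + 1) → K) :
    twoPointHermite r c d (A - A') (B - B') =
      twoPointHermite r c d A B - twoPointHermite r c d A' B' := by
  simp only [twoPointHermite, ← sum_sub_distrib, Pi.sub_apply, C_sub]
  exact sum_congr rfl fun m _ => by ring

lemma eval_iterate_derivative_twoPointHermite_left [CharZero K] {r : ℕ} {c d : K} (hcd : c ≠ d)
    (A B : Fin (r + 1) → K) (q : Fin (r + 1)) :
    (derivative^[q] (twoPointHermite r c d A B)).eval c = A q := by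
  have hterm (m : Fin (r + 1)) :
      (derivative^[q] (C (A m) * hermiteBasis r m c d + C (B m) * hermiteBasis r m d c)).eval c =
        if q = m then A m else 0 := by
    rw [iterate_map_add, iterate_derivative_C_mul, iterate_derivative_C_mul, eval_add,
      eval_C_mul, eval_C_mul,
      eval_iterate_derivative_hermiteBasis_left (Fin.is_le m) (Fin.is_le q),
      eval_iterate_derivative_hermiteBasis_right hcd.symm (Fin.is_le q)]
    simp [Fin.ext_iff]
  simp only [twoPointHermite, iterate_derivative_sum, eval_finsetSum, hterm, sum_ite_eq, mem_univ,
    if_true]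

lemma eval_iterate_derivative_twoPointHermite_right [CharZero K] {r : ℕ} {c d : K} (hcd : c ≠ d)
    (A B : Fin (r + 1) → K) (q : Fin (r + 1)) :
    (derivative^[q] (twoPointHermite r c d A B)).eval d = B q := by
  rw [twoPointHermite_swap]
  exact eval_iterate_derivative_twoPointHermite_left hcd.symm B A q

lemma hermite_eq_eval_twoPointHermite (r : ℕ) (F : Matrix (Fin 2) (Fin (r + 1)) ℝ) (x : ℝ) :
    hermite r F x = (twoPointHermite r 0 (-1) (F 0) (F 1)).eval x := by
  have hleft (m : ℕ) : (hermiteBasis r m (0 : ℝ) (-1)).eval x = (1 + x) ^ (r + 1) *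
      (1 / m.factorial * ∑ i ∈ range (r - m + 1), (-1) ^ i * ((r + i).choose i : ℝ) *
        x ^ (m + i)) := by
    simp only [hermiteBasis, truncNegBinomial, eval_mul, eval_pow, eval_sub, eval_one, eval_X,
      eval_C, eval_comp, eval_finsetSum, mul_sum]
    refine sum_congr rfl fun i _ => ?_
    norm_num [neg_pow x i]
    ring
  have hright (m : ℕ) : (hermiteBasis r m (-1 : ℝ) 0).eval x = (-x) ^ (r + 1) *
      (1 / m.factorial * ∑ i ∈ range (r - m + 1), ((r + i).choose i : ℝ) * (1 + x) ^ (m + i)) := by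
    simp only [hermiteBasis, truncNegBinomial, eval_mul, eval_pow, eval_sub, eval_one, eval_X,
      eval_C, eval_comp, eval_finsetSum, mul_sum]
    refine sum_congr rfl fun i _ => ?_
    norm_num
    ring
  simp only [hermite, twoPointHermite, eval_finsetSum, eval_add, eval_C_mul, hleft, hright,
    sum_add_distrib]
  rw [mul_sum, mul_sum]
  congr 1 <;> exact sum_congr rfl fun m _ => by ring

end HermiteInterpolation

section PiecewiseRegularity

lemma hasDerivAt_iteratedDeriv {E : Type*} [NormedAddCommGroup E] [NormedSpace ℝ E] {f : ℝ → E}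
    {U : Set ℝ} (hU : IsOpen U) {m n : ℕ} (hf : ContDiffOn ℝ n f U) (hmn : m < n) {x : ℝ}
    (hx : x ∈ U) : HasDerivAt (iteratedDeriv m f) (iteratedDeriv (m + 1) f x) x := by
  rw [iteratedDeriv_succ]
  exact (((hf.differentiableOn_iteratedDerivWithin (by exact_mod_cast hmn) hU.uniqueDiffOn).congr
    fun y hy => (iteratedDerivWithin_of_isOpen hU hy).symm).differentiableAt
      (hU.mem_nhds hx)).hasDerivAt

lemma exists_lipschitzOnWith_Ioo_of_hasDerivAt {E : Type*} [NormedAddCommGroup E]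
    [NormedSpace ℝ E] {g g' : ℝ → E} {a b : ℝ} (hg' : ContinuousOn g' (Set.Icc a b))
    (hg : ∀ x ∈ Set.Ioo a b, HasDerivAt g (g' x) x) : ∃ K, LipschitzOnWith K g (Set.Ioo a b) := by
  obtain ⟨M, hM⟩ := isCompact_Icc.exists_bound_of_continuousOn hg'
  refine ⟨M.toNNReal, (convex_Ioo a b).lipschitzOnWith_of_nnnorm_hasDerivWithin_le
    (fun x hx => (hg x hx).hasDerivWithinAt) fun x hx => ?_⟩
  rw [← norm_toNNReal]
  exact Real.toNNReal_le_toNNReal (hM x (Set.Ioo_subset_Icc_self hx))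

lemma exists_continuous_eqOn_Ioo_of_hasDerivAt {g g' : ℝ → ℝ} {a b : ℝ}
    (hg' : ContinuousOn g' (Set.Icc a b)) (hg : ∀ x ∈ Set.Ioo a b, HasDerivAt g (g' x) x) :
    ∃ G : ℝ → ℝ, Continuous G ∧ Set.EqOn g G (Set.Ioo a b) := by
  obtain ⟨_, hK⟩ := exists_lipschitzOnWith_Ioo_of_hasDerivAt hg' hg
  obtain ⟨G, hG, hgG⟩ := hK.extend_real
  exact ⟨G, hG.continuous, hgG⟩

variable {r : ℕ} {f : ℝ → ℝ} {a b c d : ℝ}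

lemma exists_isDerivChain_iteratedDerivWithin (hab : a < b) (hf : ContDiffOn ℝ r f (Set.Icc a b))
    (hcd : Set.Icc c d ⊆ Set.Icc a b) (hpiece : ContDiffOn ℝ (r + 2 : ℕ) f (Set.Ioo c d))
    {h : ℝ → ℝ} (hh : ContinuousOn h (Set.Icc c d))
    (hfh : Set.EqOn (iteratedDeriv (r + 2) f) h (Set.Ioo c d)) :
    ∃ G : ℕ → ℝ → ℝ, IsDerivChain (r + 2) G c d ∧
      ∀ i ≤ r, G i = iteratedDerivWithin i f (Set.Icc a b) := by
  have hderiv {i : ℕ} (hi : i < r + 2) {x : ℝ} (hx : x ∈ Set.Ioo c d) :=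
    hasDerivAt_iteratedDeriv isOpen_Ioo hpiece hi hx
  obtain ⟨ψ, hψ, hfψ⟩ := exists_continuous_eqOn_Ioo_of_hasDerivAt hh fun x hx =>
    hfh hx ▸ hderiv (by omega : r + 1 < r + 2) hx
  let G (i : ℕ) : ℝ → ℝ :=
    if i ≤ r then iteratedDerivWithin i f (Set.Icc a b) else if i = r + 1 then ψ else h
  have hG {i : ℕ} (hi : i ≤ r) : G i = iteratedDerivWithin i f (Set.Icc a b) := if_pos hi
  have hGψ : G (r + 1) = ψ := by simp [G]
  have hGh : G (r + 2) = h := by simp [G]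
  have hinterior {i : ℕ} (hi : i ≤ r + 2) : Set.EqOn (iteratedDeriv i f) (G i) (Set.Ioo c d) := by
    intro x hx
    rcases (by omega : i ≤ r ∨ i = r + 1 ∨ i = r + 2) with hi | rfl | rfl
    · rw [hG hi]
      exact (iteratedDerivWithin_eq_iteratedDeriv (uniqueDiffOn_Icc hab)
        ((hpiece.contDiffAt (isOpen_Ioo.mem_nhds hx)).of_le (by exact_mod_cast (by omega)))
        (hcd (Set.Ioo_subset_Icc_self hx))).symm
    · exact hGψ ▸ hfψ hx
    · exact hGh ▸ hfh hx
  refine ⟨G, ⟨fun i hi => ?_, fun i hi x hx => ?_⟩, fun i hi => hG hi⟩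
  · rcases (by omega : i ≤ r ∨ i = r + 1 ∨ i = r + 2) with hi | rfl | rfl
    · rw [hG hi]
      exact (hf.continuousOn_iteratedDerivWithin (by exact_mod_cast hi)
        (uniqueDiffOn_Icc hab)).mono hcd
    · exact hGψ ▸ hψ.continuousOn
    · exact hGh ▸ hh
  · rw [← hinterior hi hx]
    exact (hderiv hi hx).congr_of_eventuallyEq
      ((hinterior hi.le).symm.eventuallyEq_of_mem (isOpen_Ioo.mem_nhds hx))

lemma MemD.induction_pieces (hf : MemD r f a b) (hab : a < b) {P : ℝ → ℝ → Prop}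
    (htrans : ∀ x y z, P x y → P y z → P x z)
    (hpiece : ∀ c d G, c < d → Set.Icc c d ⊆ Set.Icc a b → IsDerivChain (r + 2) G c d →
      (∀ i ≤ r, G i = iteratedDerivWithin i f (Set.Icc a b)) → P c d) : P a b := by
  obtain ⟨hC, N, t, ht, rfl, rfl, hpieces⟩ := hf
  have : IsTrans ℝ P := ⟨htrans⟩
  refine (Fin.liftFun_iff_succ P).2 (fun j => ?_) (ht.lt_iff_lt.1 hab)
  obtain ⟨hCj, h, hh, hfh⟩ := hpieces j
  have hsub : Set.Icc (t j.castSucc) (t j.succ) ⊆ Set.Icc (t 0) (t (Fin.last N)) :=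
    Set.Icc_subset_Icc (ht.monotone (Fin.zero_le _)) (ht.monotone (Fin.le_last _))
  obtain ⟨G, hG, hGf⟩ := exists_isDerivChain_iteratedDerivWithin hab hC hsub hCj hh hfh
  exact hpiece _ _ G (ht j.castSucc_lt_succ) hsub hG hGf

lemma MemD.hasBoundaryExpansion (hf : MemD r f a b) (hab : a < b) :
    HasBoundaryExpansion (r + 1)
      (fun i x => ((iteratedDerivWithin i f (Set.Icc a b) x : ℝ) : ℂ)) a b :=
  hf.induction_pieces hab (fun _ _ _ => HasBoundaryExpansion.trans) fun c d G hcd _ hG hGf =>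
    (hG.ofReal.hasBoundaryExpansion hcd.le).congr (fun x _ => by rw [hGf 0 (Nat.zero_le r)])
      (fun i hi => by rw [hGf i (by omega)]) fun i hi => by rw [hGf i (by omega)]

lemma exists_lipschitzOnWith_Icc_of_Icc_Icc {E : Type*} [PseudoMetricSpace E] {g : ℝ → E}
    (hab : ∃ K, LipschitzOnWith K g (Set.Icc a b)) (hbc : ∃ K, LipschitzOnWith K g (Set.Icc b c)) :
    ∃ K, LipschitzOnWith K g (Set.Icc a c) := by
  obtain ⟨K₁, hK₁⟩ := hab
  obtain ⟨K₂, hK₂⟩ := hbc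
  refine ⟨max K₁ K₂, LipschitzOnWith.of_dist_le_mul fun x hx y hy => ?_⟩
  wlog hxy : x ≤ y generalizing x y
  · rw [dist_comm, dist_comm x]
    exact this y hy x hx (le_of_not_ge hxy)
  have hleft := (hK₁.weaken (le_max_left K₁ K₂)).dist_le_mul
  have hright := (hK₂.weaken (le_max_right K₁ K₂)).dist_le_mul
  rcases le_total y b with hyb | hby
  · exact hleft x ⟨hx.1, hxy.trans hyb⟩ y ⟨hy.1, hyb⟩
  rcases le_total b x with hbx | hxb
  · exact hright x ⟨hbx, hx.2⟩ y ⟨hby, hy.2⟩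
  calc dist (g x) (g y) ≤ dist (g x) (g b) + dist (g b) (g y) := dist_triangle _ _ _
    _ ≤ max K₁ K₂ * dist x b + max K₁ K₂ * dist b y :=
      add_le_add (hleft x ⟨hx.1, hxb⟩ b ⟨hx.1.trans hxb, le_rfl⟩)
        (hright b ⟨le_rfl, hby.trans hy.2⟩ y ⟨hby, hy.2⟩)
    _ = max K₁ K₂ * dist x y := by
      rw [← mul_add, Real.dist_eq, Real.dist_eq, Real.dist_eq, abs_of_nonpos (by linarith),
        abs_of_nonpos (by linarith), abs_of_nonpos (by linarith)]
      ring

lemma IsDerivChain.exists_lipschitzOnWith {E : Type*} [NormedAddCommGroup E] [NormedSpace ℝ E]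
    {n i : ℕ} {G : ℕ → ℝ → E} (hab : a < b) (hG : IsDerivChain n G a b) (hi : i < n) :
    ∃ K, LipschitzOnWith K (G i) (Set.Icc a b) := by
  obtain ⟨K, hK⟩ :=
    exists_lipschitzOnWith_Ioo_of_hasDerivAt (hG.continuousOn (i + 1) hi) (hG.hasDerivAt i hi)
  have hcont := hG.continuousOn i hi.le
  rw [← closure_Ioo hab.ne] at hcont ⊢
  exact ⟨K, hK.closure hcont⟩

lemma MemD.exists_lipschitzOnWith_iteratedDerivWithin (hf : MemD r f a b) (hab : a < b) {i : ℕ}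
    (hi : i ≤ r) : ∃ K, LipschitzOnWith K (iteratedDerivWithin i f (Set.Icc a b)) (Set.Icc a b) :=
  hf.induction_pieces hab (P := fun c d => ∃ K, LipschitzOnWith K
      (iteratedDerivWithin i f (Set.Icc a b)) (Set.Icc c d))
    (fun _ _ _ => exists_lipschitzOnWith_Icc_of_Icc_Icc) fun c d G hcd _ hG hGf =>
      hGf i hi ▸ hG.exists_lipschitzOnWith hcd (by omega)

end PiecewiseRegularity

section Taylor

variable {E : Type*} [NormedAddCommGroup E] [NormedSpace ℝ E]

theorem norm_sub_taylorWithinEval_le {f : ℝ → E} {s : Set ℝ} (hs : Convex ℝ s)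
    (hs' : UniqueDiffOn ℝ s) {n : ℕ} (hf : ContDiffOn ℝ n f s) {K : NNReal}
    (hK : LipschitzOnWith K (iteratedDerivWithin n f s) s) {x₀ x : ℝ} (hx₀ : x₀ ∈ s) (hx : x ∈ s) :
    ‖f x - taylorWithinEval f n s x₀ x‖ ≤ K * |x - x₀| ^ (n + 1) := by
  induction n generalizing f x with
  | zero =>
    simpa only [iteratedDerivWithin_zero, taylor_within_zero_eval, zero_add, pow_one,
      Real.norm_eq_abs] using hK.norm_sub_le hx hx₀
  | succ n ih =>
    have hsub : Set.uIcc x₀ x ⊆ s := hs.ordConnected.uIcc_subset hx₀ hx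
    have hderiv {y : ℝ} (hy : y ∈ Set.uIcc x₀ x) :
        HasDerivWithinAt (fun z => f z - taylorWithinEval f (n + 1) s x₀ z)
          (derivWithin f s y - taylorWithinEval (derivWithin f s) n s x₀ y) (Set.uIcc x₀ x) y :=
      ((hf.differentiableOn (by simp) y (hsub hy)).hasDerivWithinAt.mono hsub).sub
        (hasDerivAt_taylorWithinEval_succ f n).hasDerivWithinAt
    have hbound {y : ℝ} (hy : y ∈ Set.uIcc x₀ x) :
        ‖derivWithin f s y - taylorWithinEval (derivWithin f s) n s x₀ y‖ ≤
          K * |x - x₀| ^ (n + 1) := by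
      rw [iteratedDerivWithin_succ'] at hK
      refine (ih (hf.derivWithin hs' (by norm_cast)) hK (hsub hy)).trans ?_
      gcongr K * ?_ ^ _
      exact Set.abs_sub_left_of_mem_uIcc hy
    simpa only [taylorWithinEval_self, sub_self, sub_zero, Real.norm_eq_abs, mul_assoc, ← pow_succ]
      using (convex_uIcc x₀ x).norm_image_sub_le_of_norm_hasDerivWithin_le (fun _ => hderiv)
        (fun _ => hbound) Set.left_mem_uIcc Set.right_mem_uIcc

end Taylor

section FiniteDifferences

variable {m p q l n : ℕ} {c : ℕ → ℝ} {σ : ℝ}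

lemma finiteDiff_sub (σ : ℝ) (m p : ℕ) (c : ℕ → ℝ) (n : ℕ) (g h : ℝ → ℝ) (x : ℝ) :
    finiteDiff σ m p c n (fun y => g y - h y) x =
      finiteDiff σ m p c n g x - finiteDiff σ m p c n h x := by
  simp only [finiteDiff, mul_sub, sum_sub_distrib]

lemma finiteDiff_sub_pow (σ : ℝ) (m p : ℕ) (c : ℕ → ℝ) (n : ℕ) (x : ℝ) (q : ℕ) :
    finiteDiff σ m p c n (fun y => (y - x) ^ q) x =
      (σ * n) ^ m * (σ / n) ^ q * ∑ k ∈ range (m + p), c k * (k : ℝ) ^ q := by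
  rw [finiteDiff, mul_assoc, mul_sum _ _ ((σ / n) ^ q)]
  congr 1
  refine sum_congr rfl fun k _ => ?_
  rw [add_sub_cancel_left, mul_left_comm, ← mul_pow]
  ring

lemma HasAccuracy.sum_mul_pow (hc : HasAccuracy m p c) (hq : q < m + p) :
    ∑ k ∈ range (m + p), c k * (k : ℝ) ^ q = if m = q then (q.factorial : ℝ) else 0 := by
  set S := ∑ k ∈ range (m + p), c k * (k : ℝ) ^ q
  set D : ℝ := if m = q then (q.factorial : ℝ) else 0
  have hmonomial : (fun n : ℕ => (n : ℝ) ^ m * (1 / n) ^ q * S - D)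
      =O[atTop] fun n : ℕ => 1 / (n : ℝ) ^ p := by
    have := hc 1 (Or.inl rfl) (fun y => (y - 0) ^ q) (by fun_prop) 0
    simp only [finiteDiff_sub_pow, one_mul] at this
    simpa only [sub_zero, iteratedDeriv_fun_pow_zero, Nat.cast_ite, Nat.cast_zero] using this
  have hrescaled : (fun n : ℕ => (n : ℝ) ^ q / n ^ m * (n ^ m * (1 / n) ^ q * S - D))
      =ᶠ[atTop] fun _ => S - D := by
    filter_upwards [eventually_ne_atTop 0] with n hn
    have : (n : ℝ) ≠ 0 := by exact_mod_cast hn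
    have hD : (n : ℝ) ^ q / n ^ m * D = D := by
      by_cases hmq : m = q
      · rw [hmq, div_self (by positivity), one_mul]
      · simp only [D, if_neg hmq, mul_zero]
    rw [mul_sub, hD, one_div, inv_pow]
    field_simp
  have hdecay : (fun n : ℕ => (n : ℝ) ^ q / n ^ m * (1 / (n : ℝ) ^ p))
      =O[atTop] fun n : ℕ => 1 / (n : ℝ) := by
    refine Asymptotics.IsBigO.of_bound' ?_
    filter_upwards [eventually_ge_atTop 1] with n hn
    have hn1 : (1 : ℝ) ≤ n := by exact_mod_cast hn
    rw [Real.norm_of_nonneg (by positivity), Real.norm_of_nonneg (by positivity),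
      div_mul_div_comm, mul_one, ← pow_add, div_le_div_iff₀ (by positivity) (by positivity),
      one_mul, ← pow_succ]
    exact pow_le_pow_right₀ hn1 hq
  have hlim : Tendsto (fun _ : ℕ => S - D) atTop (𝓝 0) :=
    (hrescaled.symm.isBigO.trans (((Asymptotics.isBigO_refl _ _).mul hmonomial).trans
      hdecay)).trans_tendsto tendsto_one_div_atTop_nhds_zero_nat
  exact sub_eq_zero.1 (tendsto_nhds_unique tendsto_const_nhds hlim)

lemma HasAccuracy.finiteDiff_taylorWithinEval (hc : HasAccuracy m p c) (hσ : σ * σ = 1)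
    (hn : n ≠ 0) (hml : m ≤ l) (hl : l < m + p) (f : ℝ → ℝ) (s : Set ℝ) (x : ℝ) :
    finiteDiff σ m p c n (taylorWithinEval f l s x) x = iteratedDerivWithin m f s x := by
  have hterms : finiteDiff σ m p c n (taylorWithinEval f l s x) x =
      ∑ q ∈ range (l + 1), iteratedDerivWithin q f s x / q.factorial *
        finiteDiff σ m p c n (fun y => (y - x) ^ q) x := by
    simp only [finiteDiff, taylor_within_apply, mul_sum, smul_eq_mul]
    rw [sum_comm]
    exact sum_congr rfl fun q _ => sum_congr rfl fun k _ => by ring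
  have hscale : (σ * n) ^ m * (σ / n) ^ m = 1 := by
    have hn : (n : ℝ) ≠ 0 := by exact_mod_cast hn
    rw [← mul_pow, show σ * n * (σ / n) = σ * σ by field_simp, hσ, one_pow]
  rw [hterms, sum_eq_single_of_mem m (mem_range.2 (by omega)) fun q hq hqm => by
      rw [finiteDiff_sub_pow, hc.sum_mul_pow (by rw [mem_range] at hq; omega), if_neg hqm.symm,
        mul_zero, mul_zero],
    finiteDiff_sub_pow, hscale, hc.sum_mul_pow (by omega), if_pos rfl, one_mul,
    div_mul_cancel₀ _ (by exact_mod_cast m.factorial_ne_zero)]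

lemma abs_finiteDiff_le (hσ : |σ| = 1) {g : ℝ → ℝ} {x K : ℝ}
    (hg : ∀ k < m + p, |g (x + σ * (k / n))| ≤ K * ((k : ℝ) / n) ^ q) :
    |finiteDiff σ m p c n g x| ≤
      K * (∑ k ∈ range (m + p), |c k| * (k : ℝ) ^ q) * ((n : ℝ) ^ m / (n : ℝ) ^ q) := by
  rw [finiteDiff, abs_mul, abs_pow, abs_mul, hσ, one_mul, Nat.abs_cast]
  calc (n : ℝ) ^ m * |∑ k ∈ range (m + p), c k * g (x + σ * (k / n))|
      ≤ (n : ℝ) ^ m * ∑ k ∈ range (m + p), |c k| * (K * ((k : ℝ) / n) ^ q) := by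
        gcongr
        refine (abs_sum_le_sum_abs _ _).trans (sum_le_sum fun k hk => ?_)
        rw [abs_mul]
        gcongr
        exact hg k (mem_range.1 hk)
    _ = _ := by
        simp only [mul_sum, sum_mul, div_pow]
        exact sum_congr rfl fun k _ => by ring

theorem HasAccuracy.abs_finiteDiff_sub_iteratedDerivWithin_le (hc : HasAccuracy m p c)
    (hσ : σ * σ = 1) (hn : n ≠ 0) (hml : m ≤ l) (hl : l < m + p) {f : ℝ → ℝ} {s : Set ℝ}
    (hs : Convex ℝ s) (hs' : UniqueDiffOn ℝ s) (hf : ContDiffOn ℝ l f s) {K : NNReal}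
    (hK : LipschitzOnWith K (iteratedDerivWithin l f s) s) {x : ℝ}
    (hnodes : ∀ k < m + p, x + σ * (k / n) ∈ s) :
    |finiteDiff σ m p c n f x - iteratedDerivWithin m f s x| ≤
      K * (∑ k ∈ range (m + p), |c k| * (k : ℝ) ^ (l + 1)) *
        ((n : ℝ) ^ m / (n : ℝ) ^ (l + 1)) := by
  have habs : |σ| = 1 := by
    rcases mul_self_eq_one_iff.1 hσ with rfl | rfl <;> simp
  have hx : x ∈ s := by simpa using hnodes 0 (by omega)
  rw [← hc.finiteDiff_taylorWithinEval hσ hn hml hl, ← finiteDiff_sub]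
  refine abs_finiteDiff_le habs fun k hk => ?_
  have := norm_sub_taylorWithinEval_le hs hs' hf hK hx (hnodes k hk)
  rwa [add_sub_cancel_left, abs_mul, habs, one_mul, abs_of_nonneg (by positivity)] at this

end FiniteDifferences

section BoundaryData

variable {r p : ℕ} {f : ℝ → ℝ}

lemma MemD.exists_abs_finiteDiff_sub_le (hf : MemD r f 0 1) {m : ℕ} (hm : m ≠ 0) (hmr : m ≤ r)
    (hp : p ≠ 0) {c : ℕ → ℝ} (hc : HasAccuracy m p c) :
    ∃ D, 0 ≤ D ∧ ∀ n : ℕ, n ≠ 0 → r + p ≤ n + 1 → ∀ σ x : ℝ,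
      σ = 1 ∧ x = 0 ∨ σ = -1 ∧ x = 1 →
      |finiteDiff σ m p c n f x - iteratedDerivWithin m f (Set.Icc 0 1) x| ≤
        D * ((n : ℝ) ^ m / (n : ℝ) ^ (min p r + 1)) := by
  set l := min (m + p - 1) r
  obtain ⟨K, hK⟩ := hf.exists_lipschitzOnWith_iteratedDerivWithin one_pos (min_le_right _ r : l ≤ r)
  refine ⟨K * ∑ k ∈ range (m + p), |c k| * (k : ℝ) ^ (l + 1), by positivity,
    fun n hn hrn σ x hσx => ?_⟩
  have hn1 : (1 : ℝ) ≤ n := by exact_mod_cast Nat.one_le_iff_ne_zero.2 hn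
  have hstep (k : ℕ) (hk : k < m + p) : (k : ℝ) / n ∈ Set.Icc 0 1 :=
    ⟨by positivity, (div_le_one (by positivity)).2 (by exact_mod_cast (by omega))⟩
  have hnodes (k : ℕ) (hk : k < m + p) : x + σ * (k / n) ∈ Set.Icc 0 1 := by
    obtain ⟨h0, h1⟩ := hstep k hk
    rcases hσx with ⟨rfl, rfl⟩ | ⟨rfl, rfl⟩ <;> constructor <;> linarith
  have hσ : σ * σ = 1 := by rcases hσx with ⟨rfl, -⟩ | ⟨rfl, -⟩ <;> norm_num
  refine (hc.abs_finiteDiff_sub_iteratedDerivWithin_le hσ hn (by omega) (by omega)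
    (convex_Icc 0 1) (uniqueDiffOn_Icc one_pos)
    (hf.1.of_le (by exact_mod_cast min_le_right _ r)) hK hnodes).trans ?_
  have hl1 : min p r + 1 ≤ l + 1 := by omega
  exact mul_le_mul_of_nonneg_left
    (div_le_div_of_nonneg_left (by positivity) (by positivity) (pow_le_pow_right₀ hn1 hl1))
    (by positivity)

/-- The one-sided derivatives of `f` at `0` and at `1`, which `boundaryData` approximates. -/
noncomputable def boundaryJet (r : ℕ) (f : ℝ → ℝ) : Matrix (Fin 2) (Fin (r + 1)) ℝ :=
  ![fun m => iteratedDerivWithin m f (Set.Icc 0 1) 0,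
    fun m => iteratedDerivWithin m f (Set.Icc 0 1) 1]

lemma boundaryData_zero_right (r p : ℕ) (a : ℕ → ℕ → ℝ) (n : ℕ) (f : ℝ → ℝ) (i : Fin 2) :
    boundaryData r p a n f i 0 = boundaryJet r f i 0 := by
  fin_cases i <;> simp [boundaryData, boundaryJet]

theorem MemD.exists_abs_boundaryData_sub_le (hf : MemD r f 0 1) (hp : p ≠ 0) {a : ℕ → ℕ → ℝ}
    (ha : ∀ m, 1 ≤ m → m ≤ r → HasAccuracy m p (a m)) :
    ∃ D, 0 ≤ D ∧ ∀ n : ℕ, n ≠ 0 → r + p ≤ n + 1 → ∀ i m,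
      |boundaryData r p a n f i m - boundaryJet r f i m| ≤
        D / (n : ℝ) ^ (min p r + 1) * (n : ℝ) ^ (m : ℕ) := by
  have hcolumn (m : Fin (r + 1)) : ∃ D, 0 ≤ D ∧ ∀ n : ℕ, n ≠ 0 → r + p ≤ n + 1 → ∀ i,
      |boundaryData r p a n f i m - boundaryJet r f i m| ≤
        D / (n : ℝ) ^ (min p r + 1) * (n : ℝ) ^ (m : ℕ) := by
    rcases eq_or_ne m 0 with rfl | hm
    · exact ⟨0, le_rfl, fun n _ _ i => by simp [boundaryData_zero_right]⟩
    have hm' : (m : ℕ) ≠ 0 := Fin.val_ne_zero_iff.2 hm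
    obtain ⟨D, hD0, hD⟩ := hf.exists_abs_finiteDiff_sub_le hm' m.is_le hp
      (ha m (Nat.one_le_iff_ne_zero.2 hm') m.is_le)
    refine ⟨D, hD0, fun n hn hrn i => ?_⟩
    rw [div_mul_eq_mul_div, mul_div_assoc]
    fin_cases i
    · simpa [boundaryData, boundaryJet, hm] using hD n hn hrn 1 0 (Or.inl ⟨rfl, rfl⟩)
    · simpa [boundaryData, boundaryJet, hm] using hD n hn hrn (-1) 1 (Or.inr ⟨rfl, rfl⟩)
  choose D hD0 hD using hcolumn
  refine ⟨∑ m, D m, sum_nonneg fun m _ => hD0 m, fun n hn hrn i m => (hD m n hn hrn i).trans ?_⟩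
  gcongr
  exact single_le_sum (fun m _ => hD0 m) (mem_univ m)

end BoundaryData

section Convergence

open Polynomial

/-- The sequence of derivatives of the polynomial function `P`, with complex values. -/
noncomputable def polyJet (P : ℝ[X]) (i : ℕ) (x : ℝ) : ℂ :=
  ((derivative^[i] P).eval x : ℝ)

lemma isDerivChain_polyJet (P : ℝ[X]) (n : ℕ) (a b : ℝ) : IsDerivChain n (polyJet P) a b :=
  IsDerivChain.ofReal (G := fun i x => (derivative^[i] P).eval x)
    { continuousOn i _ := (derivative^[i] P).continuous.continuousOn
      hasDerivAt i _ x _ := by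
        simpa only [Function.iterate_succ_apply'] using
          (derivative^[i] P).hasDerivAt x }

lemma isDerivChain_zero (n : ℕ) (a b : ℝ) :
    IsDerivChain n (0 : ℕ → ℝ → ℂ) a b where
  continuousOn _ _ := continuousOn_const
  hasDerivAt _ _ x _ := hasDerivAt_const x 0

lemma trigInterp_eq_trigInterpolant {n : ℕ} {u : ℤ → ℝ} {G : ℝ → ℂ}
    (hu : ∀ j ∈ Ico (-(n : ℤ)) n, (u j : ℂ) = G (j / n)) :
    trigInterp n u = trigInterpolant n G := by
  ext x
  simp only [trigInterp, discreteCoeff, trigInterpolant_apply, gridKernel, mul_sum, sum_mul]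
  rw [sum_comm]
  refine sum_congr rfl fun j hj => sum_congr rfl fun k _ => ?_
  have hphase : wave (-k) (j / n) = Complex.exp (-(Real.pi * Complex.I * j * k / n)) := by
    rw [wave_eq_exp]
    congr 1
    push_cast
    ring
  rw [wave_sub_right, hphase, wave_eq_exp, hu j hj]
  ring

variable {r p : ℕ} {a : ℕ → ℕ → ℝ} {f : ℝ → ℝ}

lemma trigInterp_continuedData {n : ℕ} (hn : n ≠ 0) :
    trigInterp n (continuedData r p a n f) = trigInterpolant n
      (glue (polyJet (twoPointHermite r 0 (-1) (boundaryData r p a n f 0)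
        (boundaryData r p a n f 1)) 0) fun x => f x) := by
  refine trigInterp_eq_trigInterpolant fun j _ => ?_
  have hsign : (0 : ℝ) ≤ j / n ↔ 0 ≤ j := by
    rw [le_div_iff₀ (by positivity), zero_mul, Int.cast_nonneg_iff]
  simp only [continuedData, glue, hsign, polyJet, Function.iterate_zero, id_eq,
    hermite_eq_eval_twoPointHermite, apply_ite Complex.ofReal]

lemma exists_norm_trigInterpolant_glue_polyJet_zero_le {P : ℝ[X]} {m : ℕ} (hm : m ≠ 0)
    (h0 : ∀ i < m, (derivative^[i] P).eval 0 = 0)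
    (h1 : ∀ i < m, (derivative^[i] P).eval (-1) = 0) :
    ∃ C, 0 ≤ C ∧ ∀ n : ℕ, n ≠ 0 → ∀ x ∈ Set.Icc (0 : ℝ) 1,
      ‖trigInterpolant n (glue (polyJet P 0) 0) x‖ ≤ C / (n : ℝ) ^ m := by
  simpa only [Pi.zero_apply, sub_zero] using exists_norm_trigInterpolant_glue_sub_le hm
    ((isDerivChain_polyJet P (m + 1) (-1) 0).hasBoundaryExpansion (by norm_num))
    ((isDerivChain_zero (m + 1) 0 1).hasBoundaryExpansion zero_le_one)
    (fun i hi => by simp [polyJet, h0 i hi]) (fun i hi => by simp [polyJet, h1 i hi])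

lemma glue_polyJet_twoPointHermite_zero {A B : Fin (r + 1) → ℝ} (hA : A 0 = 0) (hB : B 0 = 0)
    (c d : ℝ) :
    glue (polyJet (twoPointHermite r c d A B) 0) 0 = ∑ m : Fin r,
      ((A m.succ : ℂ) • glue (polyJet (hermiteBasis r (m + 1) c d) 0) 0 +
        (B m.succ : ℂ) • glue (polyJet (hermiteBasis r (m + 1) d c) 0) 0) := by
  ext x
  rcases le_or_gt 0 x with hx | hx
  · simp [glue, hx]
  · simp [glue, hx.not_ge, polyJet, twoPointHermite, Fin.sum_univ_succ, hA, hB,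
      eval_finsetSum]

theorem exists_norm_trigInterpolant_glue_twoPointHermite_zero_le (r : ℕ) :
    ∃ C, 0 ≤ C ∧ ∀ n : ℕ, n ≠ 0 → ∀ (δ : ℝ) (A B : Fin (r + 1) → ℝ), A 0 = 0 → B 0 = 0 →
      (∀ m, |A m| ≤ δ * (n : ℝ) ^ (m : ℕ)) → (∀ m, |B m| ≤ δ * (n : ℝ) ^ (m : ℕ)) →
      ∀ x ∈ Set.Icc (0 : ℝ) 1,
        ‖trigInterpolant n (glue (polyJet (twoPointHermite r 0 (-1) A B) 0) 0) x‖ ≤ C * δ := by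
  have hflat (m : Fin r) := exists_norm_trigInterpolant_glue_polyJet_zero_le
    (P := hermiteBasis r (m + 1) 0 (-1)) (Nat.succ_ne_zero m)
    (fun i hi => by
      rw [eval_iterate_derivative_hermiteBasis_left m.2 (by omega), if_neg hi.ne])
    (fun i hi => eval_iterate_derivative_hermiteBasis_right (by norm_num) (by omega) _)
  have hflat' (m : Fin r) := exists_norm_trigInterpolant_glue_polyJet_zero_le
    (P := hermiteBasis r (m + 1) (-1) 0) (Nat.succ_ne_zero m)
    (fun i hi => eval_iterate_derivative_hermiteBasis_right (by norm_num) (by omega) _)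
    (fun i hi => by
      rw [eval_iterate_derivative_hermiteBasis_left m.2 (by omega), if_neg hi.ne])
  choose C hC0 hC using hflat
  choose C' hC0' hC' using hflat'
  refine ⟨∑ m, (C m + C' m), sum_nonneg fun m _ => add_nonneg (hC0 m) (hC0' m),
    fun n hn δ A B hA0 hB0 hA hB x hx => ?_⟩
  have hpow (m : ℕ) : (n : ℝ) ^ m ≠ 0 := by positivity
  have hcancel {α K y : ℝ} {m : ℕ} (hα : |α| ≤ δ * (n : ℝ) ^ m) (hy0 : 0 ≤ y)
      (hy : y ≤ K / (n : ℝ) ^ m) : |α| * y ≤ K * δ :=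
    (mul_le_mul hα hy hy0 ((abs_nonneg α).trans hα)).trans_eq (by have := hpow m; field_simp)
  rw [glue_polyJet_twoPointHermite_zero hA0 hB0, map_sum, Finset.sum_apply, sum_mul]
  refine norm_sum_le_of_le _ fun m _ => ?_
  rw [map_add, map_smul, map_smul, Pi.add_apply, Pi.smul_apply, Pi.smul_apply, add_mul]
  refine norm_add_le_of_le ?_ ?_ <;> rw [norm_smul, Complex.norm_real, Real.norm_eq_abs]
  · exact hcancel (hA m.succ) (norm_nonneg _) (hC m n hn x hx)
  · exact hcancel (hB m.succ) (norm_nonneg _) (hC' m n hn x hx)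

theorem MemD.exists_norm_trigInterpolant_glue_boundaryJet_sub_le (hf : MemD r f 0 1) :
    ∃ C, 0 ≤ C ∧ ∀ n : ℕ, n ≠ 0 → ∀ x ∈ Set.Icc (0 : ℝ) 1,
      ‖trigInterpolant n (glue (polyJet
        (twoPointHermite r 0 (-1) (boundaryJet r f 0) (boundaryJet r f 1)) 0) fun x => f x) x -
          f x‖ ≤ C / (n : ℝ) ^ (r + 1) := by
  have hnodes : (0 : ℝ) ≠ -1 := by norm_num
  simpa only [iteratedDerivWithin_zero] using
    exists_norm_trigInterpolant_glue_sub_le (Nat.succ_ne_zero r)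
      ((isDerivChain_polyJet (twoPointHermite r 0 (-1) (boundaryJet r f 0) (boundaryJet r f 1))
        (r + 1 + 1) (-1) 0).hasBoundaryExpansion (by norm_num))
      (hf.hasBoundaryExpansion one_pos)
      (fun i hi => congrArg Complex.ofReal
        (eval_iterate_derivative_twoPointHermite_left hnodes _ _ ⟨i, hi⟩))
      fun i hi => congrArg Complex.ofReal
        (eval_iterate_derivative_twoPointHermite_right hnodes _ _ ⟨i, hi⟩)

lemma glue_polyJet_twoPointHermite_sub (r : ℕ) (c d : ℝ) (A B A' B' : Fin (r + 1) → ℝ)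
    (ψ : ℝ → ℂ) :
    glue (polyJet (twoPointHermite r c d A B) 0) ψ =
      glue (polyJet (twoPointHermite r c d A' B') 0) ψ +
        glue (polyJet (twoPointHermite r c d (A - A') (B - B')) 0) 0 := by
  ext x
  rcases le_or_gt 0 x with hx | hx
  · simp [glue, hx]
  · simp [glue, hx.not_ge, polyJet, twoPointHermite_sub]

theorem exists_norm_trigInterp_continuedData_sub_le (hf : MemD r f 0 1) :
    ∃ C₁ C₂, 0 ≤ C₁ ∧ 0 ≤ C₂ ∧ ∀ n : ℕ, n ≠ 0 → ∀ δ : ℝ,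
      (∀ i m, |boundaryData r p a n f i m - boundaryJet r f i m| ≤ δ * (n : ℝ) ^ (m : ℕ)) →
      ∀ x ∈ Set.Icc (0 : ℝ) 1,
        ‖trigInterp n (continuedData r p a n f) x - f x‖ ≤ C₁ / (n : ℝ) ^ (r + 1) + C₂ * δ := by
  obtain ⟨C₁, hC₁0, hC₁⟩ := hf.exists_norm_trigInterpolant_glue_boundaryJet_sub_le
  obtain ⟨C₂, hC₂0, hC₂⟩ := exists_norm_trigInterpolant_glue_twoPointHermite_zero_le r
  refine ⟨C₁, C₂, hC₁0, hC₂0, fun n hn δ hδ x hx => ?_⟩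
  have hvalues (i : Fin 2) : (boundaryData r p a n f i - boundaryJet r f i) 0 = 0 := by
    rw [Pi.sub_apply, boundaryData_zero_right, sub_self]
  rw [trigInterp_continuedData hn, glue_polyJet_twoPointHermite_sub r _ _ _ _
    (boundaryJet r f 0) (boundaryJet r f 1), map_add, Pi.add_apply, add_sub_right_comm]
  exact norm_add_le_of_le (hC₁ n hn x hx)
    (hC₂ n hn δ _ _ (hvalues 0) (hvalues 1) (hδ 0) (hδ 1) x hx)

end Convergence

end FourierContinuation

theorem mainTheorem5 (r p : ℕ) (hp : 1 ≤ p) (a : ℕ → ℕ → ℝ)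
    (ha : ∀ m : ℕ, 1 ≤ m → m ≤ r → FourierContinuation.HasAccuracy m p (a m))
    (f : ℝ → ℝ) (hf : FourierContinuation.MemD r f 0 1) :
    ∃ C : ℝ, 0 < C ∧ ∀ n : ℕ, 1 ≤ n → r + p ≤ n + 1 → ∀ x ∈ Set.Icc (0 : ℝ) 1,
      ‖FourierContinuation.trigInterp n (FourierContinuation.continuedData r p a n f) x
          - (f x : ℂ)‖ ≤ C / (n : ℝ) ^ (min p r + 1) := by
  obtain ⟨C₁, C₂, hC₁, hC₂, herror⟩ :=
    FourierContinuation.exists_norm_trigInterp_continuedData_sub_le hf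
  obtain ⟨D, hD, hdata⟩ := hf.exists_abs_boundaryData_sub_le (by omega) ha
  refine ⟨C₁ + C₂ * D + 1, by positivity, fun n hn hrn x hx => ?_⟩
  have hn0 : n ≠ 0 := by omega
  have hn1 : (1 : ℝ) ≤ n := by exact_mod_cast hn
  calc _ ≤ C₁ / (n : ℝ) ^ (r + 1) + C₂ * (D / (n : ℝ) ^ (min p r + 1)) :=
        herror n hn0 _ (hdata n hn0 hrn) x hx
    _ ≤ C₁ / (n : ℝ) ^ (min p r + 1) + C₂ * (D / (n : ℝ) ^ (min p r + 1)) := by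
        gcongr
        exact min_le_right p r
    _ = (C₁ + C₂ * D) / (n : ℝ) ^ (min p r + 1) := by ring
    _ ≤ (C₁ + C₂ * D + 1) / (n : ℝ) ^ (min p r + 1) :=
        div_le_div_of_nonneg_right (lt_add_one _).le (by positivity)
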